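/- **Relative Completeness.** *Conventions.* A dioid is an idempotent semiring, ordered by $a\le b\iff a+b=b$. For a monoid $M$, let $\mathcal R M$ be the set of regular subsets of $M$: the least family of subsets that contains the finite sets and is closed under union, elementwise product and iteration $A\mapsto A^*=\bigcup_{n}A^n$; it is a dioid under union and elementwise product. For a dioid $D$, $\mathcal R D$ refers to the multiplicative monoid of $D$. An $\mathcal R$-dioid is a dioid $D$ in which every $A\in\mathcal R D$ has a least upper bound $\sum A$ and $\sum(AB)=(\sum A)(\sum B)$ for all $A,B\in\mathcal R D$; one puts $c^*=\sum\{c^n : n\in\mathbb N\}$. (These are the $*$-continuous Kleene algebras.) Each $\mathcal R M$ is an $\mathcal R$-dioid. An $\mathcal R$-congruence on $D$ is a dioid congruence $\rho$ such that, for all $U,U'\in\mathcal R D$, if the sets $\{u/\rho : u\in U\}$ and $\{u'/\rho : u'\in U'\}$ have the same downward closure in $D/\rho$, then $(\sum U)/\rho=(\sum U')/\rho$. Let $\Delta_m=\{p_0,\dots,p_{m-1},q_0,\dots,q_{m-1}\}$. The polycyclic $\mathcal R$-dioid $C_m'$ is the quotient of $\mathcal R\Delta_m^*$ by the least $\mathcal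 R$-congruence containing the relations $p_iq_j=\delta_{i,j}$ $(i,j<m)$. The tensor product $K\otimes_{\mathcal R}C$ of two $\mathcal R$-dioids is the quotient of $\mathcal R(K\times C)$ by the least $\mathcal R$-congruence containing the relations $A\times B=\{(\sum A,\sum B)\}$ for $A\in\mathcal R K$, $B\in\mathcal R C$. Elements $k\in K$ and $c\in C$ are written also for their images, the classes of $\{(k,1)\}$ and $\{(1,c)\}$. A polynomial $\varphi(x)\in D[x]$ over an $\mathcal R$-dioid $D$ is a regular expression (built with $0,1,+,\cdot,{}^*$) in elements of $D$ and an unknown $x$ (which need not commute with the coefficients); $\varphi(d)$ is its value at $x=d\in D$. *Theorem.* Let $K$ be an $\mathcal R$-dioid, $m\ge 2$, and $e=\sum_{i<m}q_ip_i\in K\otimes_{\mathcal R}C_m'$. Let $\varphi(x)$ be a polynomial over $K\otimes_{\mathcal R}C_m'$ in which $p_0$ and $q_0$ occur only in $\pi=q_0p_0$; that is, each of its coefficients is the value of a regular expression in elements of $K$, the element $\pi$, and the brackets $p_1,\dots,p_{m-1},q_1,\dots,q_{m-1}$. Then $$p_0\,\varphi(e)\,q_0=p_0\,\varphi(1)\,q_0,$$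 and $p_0\,\varphi(1)\,q_0$ belongs to the centralizer of $C_m'$ in $K\otimes_{\mathcal R}C_m'$, that is, it commutes with every element of (the image of) $C_m'$. -/

import Mathlib

open scoped Pointwise

/-- The regular (rational) subsets of a monoid: the least family containing the finite sets
that is closed under union, elementwise product and iteration `A ↦ ⋃ n, A ^ n`
(the submonoid generated by `A`). -/
inductive IsRational {M : Type*} [Monoid M] : Set M → Prop
  | empty : IsRational ∅
  | singleton (a : M) : IsRational {a}
  | union {A B : Set M} : IsRational A → IsRational B → IsRational (A ∪ B)
  | mul {A B : Set M} : IsRational A → IsRational B → IsRational (A * B)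
  | star {A : Set M} : IsRational A → IsRational (Submonoid.closure A : Set M)

/-- An `R`-dioid: a dioid (idempotent semiring, with its natural order `a ≤ b ↔ a + b = b`) in
which every regular set has a least upper bound, and `∑ (A B) = (∑ A) (∑ B)` for regular sets. -/
class IsRDioid (D : Type*) [IdemSemiring D] : Prop where
  exists_isLUB : ∀ A : Set D, IsRational A → ∃ s, IsLUB A s
  isLUB_mul : ∀ A B : Set D, IsRational A → IsRational B →
    ∀ a b : D, IsLUB A a → IsLUB B b → IsLUB (A * B) (a * b)

section RDioid

variable {D : Type*} [IdemSemiring D] [IsRDioid D]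

/-- The least upper bound of a regular set of an `R`-dioid. -/
noncomputable def rsum (A : Set D) (hA : IsRational A) : D :=
  (IsRDioid.exists_isLUB A hA).choose

theorem isLUB_rsum (A : Set D) (hA : IsRational A) : IsLUB A (rsum A hA) :=
  (IsRDioid.exists_isLUB A hA).choose_spec

/-- Iteration in an `R`-dioid: `c^* = ∑ {c}^* = ∑ {c ^ n | n ∈ ℕ}`. -/
noncomputable def rstar (c : D) : D :=
  rsum (Submonoid.closure {c} : Set D) (.star (.singleton c))

end RDioid

/-! ### The `R`-dioid of regular subsets of a monoid -/

/-- The regular subsets of a monoid `M`. -/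
@[ext] structure RegSet (M : Type*) [Monoid M] where
  /-- The underlying set. -/
  carrier : Set M
  isRational : IsRational carrier

namespace RegSet

variable {M : Type*} [Monoid M]

/-- `{a}` as a regular set. -/
def single (a : M) : RegSet M := ⟨{a}, .singleton a⟩

instance : Zero (RegSet M) := ⟨⟨∅, .empty⟩⟩
instance : One (RegSet M) := ⟨⟨{1}, .singleton 1⟩⟩
instance : Add (RegSet M) := ⟨fun A B => ⟨A.1 ∪ B.1, .union A.2 B.2⟩⟩
instance : Mul (RegSet M) := ⟨fun A B => ⟨A.1 * B.1, .mul A.2 B.2⟩⟩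

theorem val_zero : (0 : RegSet M).1 = ∅ := rfl
theorem val_one : (1 : RegSet M).1 = {1} := rfl
theorem val_add (A B : RegSet M) : (A + B).1 = A.1 ∪ B.1 := rfl
theorem val_mul (A B : RegSet M) : (A * B).1 = A.1 * B.1 := rfl

instance : Semiring (RegSet M) where
  add_assoc A B C := RegSet.ext (Set.union_assoc _ _ _)
  zero_add A := RegSet.ext (Set.empty_union _)
  add_zero A := RegSet.ext (Set.union_empty _)
  add_comm A B := RegSet.ext (Set.union_comm _ _)
  left_distrib A B C := RegSet.ext Set.mul_union
  right_distrib A B C := RegSet.ext Set.union_mul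
  zero_mul A := RegSet.ext Set.empty_mul
  mul_zero A := RegSet.ext Set.mul_empty
  mul_assoc A B C := RegSet.ext (mul_assoc A.1 B.1 C.1)
  one_mul A := RegSet.ext (one_mul A.1)
  mul_one A := RegSet.ext (mul_one A.1)
  nsmul := nsmulRec

instance : IdemSemiring (RegSet M) :=
  IdemSemiring.ofSemiring fun A => RegSet.ext (Set.union_self A.1)

theorem le_iff {A B : RegSet M} : A ≤ B ↔ A.1 ⊆ B.1 := by
  rw [← add_eq_right_iff_le, ← Set.union_eq_right]
  exact ⟨fun h => congrArg carrier h, fun h => RegSet.ext h⟩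

/-- Regular unions of regular sets are regular. -/
theorem isRational_biUnion {U : Set (RegSet M)} (hU : IsRational U) :
    IsRational (⋃ A ∈ U, A.1) := by
  induction hU with
  | empty => simpa using IsRational.empty
  | singleton A => simpa using A.2
  | union _ _ h₁ h₂ => rw [Set.biUnion_union]; exact h₁.union h₂
  | @mul U V _ _ h₁ h₂ =>
    convert h₁.mul h₂ using 1
    ext x
    simp only [Set.mem_iUnion, Set.mem_mul, exists_prop]
    constructor
    · rintro ⟨_, ⟨A, hA, B, hB, rfl⟩, a, ha, b, hb, rfl⟩
      exact ⟨a, ⟨A, hA, ha⟩, b, ⟨B, hB, hb⟩, rfl⟩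
    · rintro ⟨a, ⟨A, hA, ha⟩, b, ⟨B, hB, hb⟩, rfl⟩
      exact ⟨A * B, ⟨A, hA, B, hB, rfl⟩, a, ha, b, hb, rfl⟩
  | @star U _ h =>
    convert h.star using 1
    apply Set.Subset.antisymm
    · refine Set.iUnion₂_subset fun A hA => ?_
      induction hA using Submonoid.closure_induction with
      | mem A hA =>
        exact Set.Subset.trans (Set.subset_biUnion_of_mem (u := fun A : RegSet M => A.1) hA)
          Submonoid.subset_closure
      | one => rw [val_one]; simp
      | mul A B _ _ hA hB =>
        rw [val_mul]
        rintro _ ⟨a, ha, b, hb, rfl⟩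
        exact mul_mem (hA ha) (hB hb)
    · intro x hx
      simp only [Set.mem_iUnion, exists_prop]
      induction hx using Submonoid.closure_induction with
      | mem x hx =>
        simp only [Set.mem_iUnion, exists_prop] at hx
        obtain ⟨A, hA, hx⟩ := hx
        exact ⟨A, Submonoid.subset_closure hA, hx⟩
      | one => exact ⟨1, one_mem _, rfl⟩
      | mul x y _ _ hx hy =>
        obtain ⟨A, hA, hx⟩ := hx
        obtain ⟨B, hB, hy⟩ := hy
        exact ⟨A * B, mul_mem hA hB, x, hx, y, hy, rfl⟩

theorem isLUB_biUnion {U : Set (RegSet M)} (hU : IsRational U) :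
    IsLUB U (⟨⋃ A ∈ U, A.1, isRational_biUnion hU⟩ : RegSet M) := by
  refine ⟨fun A hA =>
      le_iff.2 (Set.subset_biUnion_of_mem (u := fun A : RegSet M => A.1) hA),
    fun B hB => le_iff.2 (Set.iUnion₂_subset fun A hA => le_iff.1 (hB hA))⟩

instance : IsRDioid (RegSet M) where
  exists_isLUB _ hU := ⟨_, isLUB_biUnion hU⟩
  isLUB_mul U V hU hV a b ha hb := by
    have ea := ha.unique (isLUB_biUnion hU)
    have eb := hb.unique (isLUB_biUnion hV)
    have key : a * b = ⟨⋃ A ∈ U * V, A.1, isRational_biUnion (hU.mul hV)⟩ := by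
      subst ea eb
      apply RegSet.ext
      rw [val_mul]
      ext x
      simp only [Set.mem_iUnion, Set.mem_mul, exists_prop]
      constructor
      · rintro ⟨a, ⟨A, hA, ha⟩, b, ⟨B, hB, hb⟩, rfl⟩
        exact ⟨A * B, ⟨A, hA, B, hB, rfl⟩, a, ha, b, hb, rfl⟩
      · rintro ⟨_, ⟨A, hA, B, hB, rfl⟩, a, ha, b, hb, rfl⟩
        exact ⟨a, ⟨A, hA, ha⟩, b, ⟨B, hB, hb⟩, rfl⟩
    rw [key]
    exact isLUB_biUnion (hU.mul hV)

end RegSet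

/-! ### `R`-congruences and quotients -/

section Quotient

variable {D : Type*} [IdemSemiring D]

instance (ρ : RingCon D) : IdemSemiring ρ.Quotient :=
  IdemSemiring.ofSemiring fun a => by
    induction a using Quotient.inductionOn' with
    | h a => exact congrArg (RingCon.toQuotient (c := ρ)) (add_idem a)

/-- The quotient map `d ↦ d/ρ`. -/
def qmk (ρ : RingCon D) (d : D) : ρ.Quotient := (d : ρ.Quotient)

theorem qmk_le_iff {ρ : RingCon D} {a b : D} : qmk ρ a ≤ qmk ρ b ↔ ρ (a + b) b := by
  rw [← add_eq_right_iff_le]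
  exact RingCon.eq ρ

theorem lowerClosure_qmk_le_iff {ρ : RingCon D} {U V : Set D} :
    lowerClosure (qmk ρ '' U) ≤ lowerClosure (qmk ρ '' V) ↔
      ∀ u ∈ U, ∃ v ∈ V, ρ (u + v) v := by
  rw [lowerClosure_le]
  constructor
  · intro h u hu
    obtain ⟨_, ⟨v, hv, rfl⟩, hle⟩ := h ⟨u, hu, rfl⟩
    exact ⟨v, hv, qmk_le_iff.1 hle⟩
  · rintro h _ ⟨u, hu, rfl⟩
    obtain ⟨v, hv, hle⟩ := h u hu
    exact ⟨qmk ρ v, ⟨v, hv, rfl⟩, qmk_le_iff.2 hle⟩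

/-- Regular subsets of `D/ρ` are the images of regular subsets of `D`. -/
theorem exists_isRational_lift (ρ : RingCon D) {U : Set ρ.Quotient} (hU : IsRational U) :
    ∃ V : Set D, IsRational V ∧ qmk ρ '' V = U := by
  induction hU with
  | empty => exact ⟨∅, .empty, Set.image_empty _⟩
  | singleton a =>
    induction a using Quotient.inductionOn' with
    | h a => exact ⟨{a}, .singleton a, Set.image_singleton⟩
  | union _ _ h₁ h₂ =>
    obtain ⟨V, hV, rfl⟩ := h₁
    obtain ⟨W, hW, rfl⟩ := h₂
    exact ⟨V ∪ W, hV.union hW, Set.image_union ..⟩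
  | mul _ _ h₁ h₂ =>
    obtain ⟨V, hV, rfl⟩ := h₁
    obtain ⟨W, hW, rfl⟩ := h₂
    exact ⟨V * W, hV.mul hW, Set.image_mul (ρ.mk' : D →+* ρ.Quotient)⟩
  | star _ h =>
    obtain ⟨V, hV, rfl⟩ := h
    refine ⟨_, hV.star, ?_⟩
    have h := MonoidHom.map_mclosure (ρ.mk' : D →* ρ.Quotient) V
    exact congrArg (fun S : Submonoid ρ.Quotient => (S : Set ρ.Quotient)) h

variable [IsRDioid D]

/-- An `R`-congruence on an `R`-dioid: a dioid congruence `ρ` such that for regular `U`, `U'`,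
if `U/ρ` and `U'/ρ` have the same downward closure in the dioid `D/ρ`, then
`(∑ U)/ρ = (∑ U')/ρ`. -/
def IsRCongruence (ρ : RingCon D) : Prop :=
  ∀ (U U' : Set D) (hU : IsRational U) (hU' : IsRational U'),
    lowerClosure (qmk ρ '' U) = lowerClosure (qmk ρ '' U') → ρ (rsum U hU) (rsum U' hU')

/-- The least `R`-congruence containing the relation `r`. -/
def rCongGen (r : D → D → Prop) : RingCon D :=
  sInf {ρ : RingCon D | IsRCongruence ρ ∧ ∀ x y, r x y → ρ x y}

/-- The quotient of an `R`-dioid by the `R`-congruence generated by the relation `r`. -/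
abbrev RQuot (r : D → D → Prop) : Type _ := (rCongGen r).Quotient

theorem isRCongruence_rCongGen (r : D → D → Prop) : IsRCongruence (rCongGen r) := by
  intro U V hU hV h ρ hρ
  refine hρ.1 U V hU hV (le_antisymm ?_ ?_)
  · rw [lowerClosure_qmk_le_iff]
    intro u hu
    obtain ⟨v, hv, huv⟩ := lowerClosure_qmk_le_iff.1 h.le u hu
    exact ⟨v, hv, huv ρ hρ⟩
  · rw [lowerClosure_qmk_le_iff]
    intro u hu
    obtain ⟨v, hv, huv⟩ := lowerClosure_qmk_le_iff.1 h.ge u hu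
    exact ⟨v, hv, huv ρ hρ⟩

theorem rCongGen_of {r : D → D → Prop} {x y : D} (h : r x y) : rCongGen r x y :=
  fun _ hρ => hρ.2 x y h

theorem IsRCongruence.isLUB_image {ρ : RingCon D} (hρ : IsRCongruence ρ) {U : Set D}
    (hU : IsRational U) : IsLUB (qmk ρ '' U) (qmk ρ (rsum U hU)) := by
  refine ⟨?_, fun y hy => ?_⟩
  · rintro _ ⟨u, hu, rfl⟩
    refine qmk_le_iff.2 ?_
    rw [add_eq_right_iff_le.2 ((isLUB_rsum U hU).1 hu)]
    exact ρ.refl _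
  · induction y using Quotient.inductionOn' with
    | h d =>
      have hd : IsRational ({d} : Set D) := .singleton d
      have key : ρ (rsum (U ∪ {d}) (hU.union hd)) (rsum {d} hd) := by
        refine hρ _ _ _ _ (le_antisymm ?_ ?_)
        · rw [lowerClosure_qmk_le_iff]
          rintro u (hu | hu)
          · exact ⟨d, rfl, qmk_le_iff.1 (hy ⟨u, hu, rfl⟩)⟩
          · refine ⟨d, rfl, ?_⟩
            rw [Set.mem_singleton_iff.1 hu, add_idem]
            exact ρ.refl _
        · exact lowerClosure_mono (Set.image_mono Set.subset_union_right)
      have e₁ : rsum {d} hd = d := (isLUB_rsum _ hd).unique isLUB_singleton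
      have e₂ : rsum (U ∪ {d}) (hU.union hd) = rsum U hU + d := by
        rw [add_eq_sup]
        exact (isLUB_rsum _ _).unique ((isLUB_rsum U hU).union isLUB_singleton)
      rw [e₁, e₂] at key
      exact qmk_le_iff.2 key

/-- The quotient of an `R`-dioid by an `R`-congruence is an `R`-dioid. -/
theorem IsRCongruence.isRDioid {ρ : RingCon D} (hρ : IsRCongruence ρ) :
    IsRDioid ρ.Quotient where
  exists_isLUB U hU := by
    obtain ⟨V, hV, rfl⟩ := exists_isRational_lift ρ hU
    exact ⟨_, hρ.isLUB_image hV⟩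
  isLUB_mul U₁ U₂ hU₁ hU₂ a b ha hb := by
    obtain ⟨V₁, hV₁, rfl⟩ := exists_isRational_lift ρ hU₁
    obtain ⟨V₂, hV₂, rfl⟩ := exists_isRational_lift ρ hU₂
    obtain rfl := ha.unique (hρ.isLUB_image hV₁)
    obtain rfl := hb.unique (hρ.isLUB_image hV₂)
    have h₁ : qmk ρ '' V₁ * qmk ρ '' V₂ = qmk ρ '' (V₁ * V₂) :=
      (Set.image_mul (ρ.mk' : D →+* ρ.Quotient)).symm
    have h₂ : rsum (V₁ * V₂) (hV₁.mul hV₂) = rsum V₁ hV₁ * rsum V₂ hV₂ :=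
      (isLUB_rsum _ _).unique
        (IsRDioid.isLUB_mul _ _ hV₁ hV₂ _ _ (isLUB_rsum _ _) (isLUB_rsum _ _))
    have h₃ : qmk ρ (rsum V₁ hV₁) * qmk ρ (rsum V₂ hV₂) =
        qmk ρ (rsum (V₁ * V₂) (hV₁.mul hV₂)) := congrArg (qmk ρ) h₂.symm
    rw [h₁, h₃]
    exact hρ.isLUB_image _

instance (r : D → D → Prop) : IsRDioid (RQuot r) := (isRCongruence_rCongGen r).isRDioid

end Quotient

/-! ### The polycyclic `R`-dioids `C_m'` -/

/-- The alphabet `Δ_m` of `m` opening brackets `p_i` and `m` closing brackets `q_i`. -/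
inductive Delta (m : ℕ) : Type
  | opening (i : Fin m) : Delta m
  | closing (i : Fin m) : Delta m

/-- The matching relations `p_i q_j = δ_{i,j}` on the regular subsets of `Δ_m^*`. -/
inductive PolycyclicRel (m : ℕ) :
    RegSet (FreeMonoid (Delta m)) → RegSet (FreeMonoid (Delta m)) → Prop
  | matching (i j : Fin m) : PolycyclicRel m
      (RegSet.single (FreeMonoid.of (.opening i)) * RegSet.single (FreeMonoid.of (.closing j)))
      (if i = j then 1 else 0)

/-- The polycyclic `R`-dioid `C_m'` on `m` bracket pairs: the quotient of the regular subsets of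
`Δ_m^*` by the least `R`-congruence containing the matching relations. -/
abbrev Polycyclic (m : ℕ) : Type := RQuot (PolycyclicRel m)

/-- The opening bracket `p_i` in `C_m'`. -/
def Polycyclic.p {m : ℕ} (i : Fin m) : Polycyclic m :=
  qmk _ (RegSet.single (FreeMonoid.of (.opening i)))

/-- The closing bracket `q_i` in `C_m'`. -/
def Polycyclic.q {m : ℕ} (i : Fin m) : Polycyclic m :=
  qmk _ (RegSet.single (FreeMonoid.of (.closing i)))

/-! ### Tensor products of `R`-dioids -/

theorem IsRational.image {M N : Type*} [Monoid M] [Monoid N] (f : M →* N) {A : Set M}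
    (hA : IsRational A) : IsRational (f '' A) := by
  induction hA with
  | empty => rw [Set.image_empty]; exact .empty
  | singleton a => rw [Set.image_singleton]; exact .singleton _
  | union _ _ h₁ h₂ => rw [Set.image_union]; exact h₁.union h₂
  | mul _ _ h₁ h₂ => rw [Set.image_mul]; exact h₁.mul h₂
  | star _ h => rw [← Submonoid.coe_map, MonoidHom.map_mclosure]; exact h.star

theorem IsRational.prod {M N : Type*} [Monoid M] [Monoid N] {A : Set M} {B : Set N}
    (hA : IsRational A) (hB : IsRational B) : IsRational (A ×ˢ B : Set (M × N)) := by
  convert (hA.image (MonoidHom.inl M N)).mul (hB.image (MonoidHom.inr M N)) using 1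
  ext ⟨a, b⟩
  simp [Set.mem_mul]

section Tensor

variable (K C : Type*) [IdemSemiring K] [IsRDioid K] [IdemSemiring C] [IsRDioid C]

/-- The tensor product equations `A × B = {(∑ A, ∑ B)}`, for regular `A ⊆ K` and `B ⊆ C`, on the
regular subsets of the product of the multiplicative monoids of `K` and `C`. -/
inductive TensorRel : RegSet (K × C) → RegSet (K × C) → Prop
  | rect (A : Set K) (B : Set C) (hA : IsRational A) (hB : IsRational B) :
      TensorRel ⟨A ×ˢ B, hA.prod hB⟩ (RegSet.single (rsum A hA, rsum B hB))

/-- The tensor product of the `R`-dioids `K` and `C`: the quotient of the regular subsets of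
`K × C` by the least `R`-congruence containing the tensor product equations. -/
abbrev RTensor : Type _ := RQuot (TensorRel K C)

variable {K C}

/-- The canonical map `a ↦ a ⊗ 1` of `K` into the tensor product. -/
def RTensor.inl (a : K) : RTensor K C := qmk _ (RegSet.single (a, 1))

/-- The canonical map `b ↦ 1 ⊗ b` of `C` into the tensor product. -/
def RTensor.inr (b : C) : RTensor K C := qmk _ (RegSet.single (1, b))

end Tensor

/-! ### Polynomials over an `R`-dioid -/

/-- Polynomials `φ(x) ∈ D[x]` in one unknown `x` (not commuting with the coefficients) over an
`R`-dioid `D`: regular expressions over the elements of `D` (`some c`) and the unknown `x`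
(`none`). -/
abbrev RPolynomial (D : Type*) : Type _ := RegularExpression (Option D)

namespace RPolynomial

variable {D : Type*}

/-- The value `φ(d)` of the polynomial `φ(x)` at `d`. -/
noncomputable def eval [IdemSemiring D] [IsRDioid D] (d : D) : RPolynomial D → D
  | .zero => 0
  | .epsilon => 1
  | .char none => d
  | .char (some c) => c
  | .plus φ ψ => eval d φ + eval d ψ
  | .comp φ ψ => eval d φ * eval d ψ
  | .star φ => rstar (eval d φ)

/-- All coefficients of the polynomial lie in the set `S`. -/
def CoeffsIn (S : Set D) : RPolynomial D → Prop
  | .zero => True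
  | .epsilon => True
  | .char none => True
  | .char (some c) => c ∈ S
  | .plus φ ψ => CoeffsIn S φ ∧ CoeffsIn S ψ
  | .comp φ ψ => CoeffsIn S φ ∧ CoeffsIn S ψ
  | .star φ => CoeffsIn S φ

end RPolynomial

/-! ### The brackets in `K ⊗ C_m'` -/

section Brackets

variable (K : Type*) [IdemSemiring K] [IsRDioid K] {m : ℕ}

/-- The image of `p_i` in `K ⊗ C_m'`. -/
def tp (i : Fin m) : RTensor K (Polycyclic m) := RTensor.inr (Polycyclic.p i)

/-- The image of `q_i` in `K ⊗ C_m'`. -/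
def tq (i : Fin m) : RTensor K (Polycyclic m) := RTensor.inr (Polycyclic.q i)

/-- The element `e = ∑_{i < m} q_i p_i`. -/
def te (m : ℕ) : RTensor K (Polycyclic m) := ∑ i : Fin m, tq K i * tp K i

/-- The elements of `K ⊗ C_m'` that are denoted by regular expressions in the elements of `K` and
in brackets, where `p_0` and `q_0` occur only in `π = q_0 p_0`: the closure of
`K ∪ {π} ∪ {p_i, q_i | 0 < i < m}` under the regular operations. -/
inductive IsPiDenoted [NeZero m] : RTensor K (Polycyclic m) → Prop
  | coeff (k : K) : IsPiDenoted (RTensor.inl k)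
  | pi : IsPiDenoted (tq K 0 * tp K 0)
  | opening (i : Fin m) (hi : i ≠ 0) : IsPiDenoted (tp K i)
  | closing (i : Fin m) (hi : i ≠ 0) : IsPiDenoted (tq K i)
  | zero : IsPiDenoted 0
  | one : IsPiDenoted 1
  | add {a b : RTensor K (Polycyclic m)} : IsPiDenoted a → IsPiDenoted b → IsPiDenoted (a + b)
  | mul {a b : RTensor K (Polycyclic m)} : IsPiDenoted a → IsPiDenoted b → IsPiDenoted (a * b)
  | star {a : RTensor K (Polycyclic m)} : IsPiDenoted a → IsPiDenoted (rstar a)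

/-- The centralizer of `C_m'` in `K ⊗ C_m'`. -/
def polycyclicCentralizer (m : ℕ) : Submonoid (RTensor K (Polycyclic m)) :=
  Submonoid.centralizer (Set.range (RTensor.inr (K := K) (C := Polycyclic m)))

end Brackets

/-! Read products from left to right as a stack machine whose state is `k p_0 p_{i_1} ⋯ p_{i_n}`
with nonzero `i_j`, or `0`. Right multiplication by elements of `K`, by `π`, and by `p_i`, `q_i`
with `i ≠ 0` preserves such states, and `e` fixes each of them (`IsStack.mul_te`), just as `1` does.
A sum of states need not be a state, so `φ(e)` and `φ(1)` are compared through their summands: they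
are the least upper bounds of the two projections of one regular set of pairs that act alike on
states (`StackRelated.eval`). By continuity of the product, `p_0 φ(e) q_0` and `p_0 φ(1) q_0` are
least upper bounds of the same set of elements `s q_0` with `s` a state. Each `s q_0` is `0` or lies
in `K`, hence commutes with `C_m'` (`IsStack.inr_mul_mul_tq_zero`), and commuting passes to the
least upper bound. -/

/-! ### Continuity of the regular operations -/

section LeastUpperBounds

variable {D : Type*} [IdemSemiring D]

theorem isLUB_empty_zero : IsLUB (∅ : Set D) 0 := by
  refine ⟨fun _ h => h.elim, fun b _ => ?_⟩
  rw [← add_eq_right_iff_le, zero_add]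

theorem IsLUB.union_add {A B : Set D} {a b : D} (ha : IsLUB A a) (hb : IsLUB B b) :
    IsLUB (A ∪ B) (a + b) := by
  rw [add_eq_sup]
  exact ha.union hb

theorem IsRational.pow {M : Type*} [Monoid M] {A : Set M} (hA : IsRational A) (n : ℕ) :
    IsRational (A ^ n) := by
  induction n with
  | zero => rw [pow_zero]; exact .singleton 1
  | succ n ih => rw [pow_succ]; exact ih.mul hA

variable [IsRDioid D]

theorem rsum_eq {A : Set D} (hA : IsRational A) {a : D} (ha : IsLUB A a) : rsum A hA = a :=
  (isLUB_rsum A hA).unique ha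

theorem IsLUB.pow_of_isRational {A : Set D} (hA : IsRational A) {a : D} (ha : IsLUB A a)
    (n : ℕ) : IsLUB (A ^ n) (a ^ n) := by
  induction n with
  | zero => rw [pow_zero, pow_zero]; exact isLUB_singleton
  | succ n ih =>
    rw [pow_succ, pow_succ]
    exact IsRDioid.isLUB_mul _ _ (hA.pow n) hA _ _ ih ha

/-- A product of elements of `A` lies below a power of `a`; conversely `a ^ n` is the least upper
bound of `A ^ n`, which is part of the generated submonoid. -/
theorem IsLUB.rstar {A : Set D} (hA : IsRational A) {a : D} (ha : IsLUB A a) :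
    IsLUB (Submonoid.closure A : Set D) (rstar a) := by
  have hs := isLUB_rsum (Submonoid.closure {a} : Set D) (.star (.singleton a))
  constructor
  · intro x hx
    have : ∃ y ∈ Submonoid.closure {a}, x ≤ y := by
      induction hx using Submonoid.closure_induction with
      | mem x hx => exact ⟨a, Submonoid.subset_closure rfl, ha.1 hx⟩
      | one => exact ⟨1, one_mem _, le_rfl⟩
      | mul x y _ _ hx hy =>
        obtain ⟨x', hx', hxx⟩ := hx
        obtain ⟨y', hy', hyy⟩ := hy
        exact ⟨x' * y', mul_mem hx' hy', mul_le_mul' hxx hyy⟩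
    obtain ⟨y, hy, hxy⟩ := this
    exact hxy.trans (hs.1 hy)
  · intro b hb
    refine hs.2 fun x hx => ?_
    obtain ⟨n, rfl⟩ := Submonoid.mem_closure_singleton.1 hx
    refine (ha.pow_of_isRational hA n).2 fun y hy => hb ?_
    obtain ⟨f, rfl⟩ := Set.mem_pow.1 hy
    refine list_prod_mem fun z hz => ?_
    obtain ⟨i, rfl⟩ := List.mem_ofFn.1 hz
    exact Submonoid.subset_closure (f i).2

theorem IsLUB.mul_mul {A : Set D} (hA : IsRational A) {a : D} (ha : IsLUB A a) (c d : D) :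
    IsLUB ((fun x => c * x * d) '' A) (c * a * d) := by
  have h := IsRDioid.isLUB_mul _ _ ((IsRational.singleton c).mul hA) (.singleton d) _ _
    (IsRDioid.isLUB_mul _ _ (.singleton c) hA _ _ isLUB_singleton ha) isLUB_singleton
  rwa [Set.singleton_mul, Set.mul_singleton, Set.image_image] at h

/-- If every element of a regular set commutes with `c`, then so does its least upper bound. -/
theorem IsLUB.commute {A : Set D} (hA : IsRational A) {a : D} (ha : IsLUB A a) {c : D}
    (hc : ∀ x ∈ A, c * x = x * c) : c * a = a * c := by
  have h₁ := ha.mul_mul hA c 1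
  have h₂ := ha.mul_mul hA 1 c
  have e : (fun x => c * x * 1) '' A = (fun x => 1 * x * c) '' A :=
    Set.image_congr fun x hx => by rw [mul_one, one_mul, hc x hx]
  rw [e] at h₁
  simpa using h₁.unique h₂

variable {M : Type*} [Monoid M] (f : M →* D)

theorem IsLUB.image_mul {A B : Set M} (hA : IsRational A) (hB : IsRational B) {a b : D}
    (ha : IsLUB (f '' A) a) (hb : IsLUB (f '' B) b) : IsLUB (f '' (A * B)) (a * b) := by
  rw [Set.image_mul]
  exact IsRDioid.isLUB_mul _ _ (hA.image f) (hB.image f) _ _ ha hb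

theorem IsLUB.image_closure {A : Set M} (hA : IsRational A) {a : D} (ha : IsLUB (f '' A) a) :
    IsLUB (f '' (Submonoid.closure A : Set M)) (_root_.rstar a) := by
  rw [← Submonoid.coe_map, MonoidHom.map_mclosure]
  exact ha.rstar (hA.image f)

end LeastUpperBounds

/-! ### Calculation in the quotients -/

theorem RegSet.single_mul_single {M : Type*} [Monoid M] (a b : M) :
    RegSet.single a * RegSet.single b = RegSet.single (a * b) :=
  RegSet.ext Set.singleton_mul_singleton

theorem qmk_mul {D : Type*} [IdemSemiring D] (ρ : RingCon D) (a b : D) :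
    qmk ρ (a * b) = qmk ρ a * qmk ρ b := rfl

namespace RTensor

variable {K C : Type*} [IdemSemiring K] [IsRDioid K] [IdemSemiring C] [IsRDioid C]

theorem inl_mul (a b : K) : (inl (a * b) : RTensor K C) = inl a * inl b := by
  rw [inl, inl, inl, ← qmk_mul, RegSet.single_mul_single, Prod.mk_mul_mk, one_mul]

theorem inr_mul (a b : C) : (inr (a * b) : RTensor K C) = inr a * inr b := by
  rw [inr, inr, inr, ← qmk_mul, RegSet.single_mul_single, Prod.mk_mul_mk, one_mul]

theorem inl_one : (inl 1 : RTensor K C) = 1 := rfl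

theorem inr_one : (inr 1 : RTensor K C) = 1 := rfl

theorem inr_zero : (inr 0 : RTensor K C) = 0 := by
  -- The rectangle `{1} × ∅` is empty, while its tensor equation replaces it by `{(1, 0)}`.
  have h := rCongGen_of (TensorRel.rect (K := K) (C := C) {1} ∅ (.singleton 1) .empty)
  rw [rsum_eq _ isLUB_singleton, rsum_eq _ isLUB_empty_zero] at h
  have e : (⟨{1} ×ˢ ∅, (IsRational.singleton (1 : K)).prod .empty⟩ : RegSet (K × C)) = 0 :=
    RegSet.ext Set.prod_empty
  rw [e] at h
  exact ((RingCon.eq _).2 h).symm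

theorem inl_mul_inr (a : K) (b : C) : (inl a : RTensor K C) * inr b = inr b * inl a := by
  rw [inl, inr, ← qmk_mul, ← qmk_mul, RegSet.single_mul_single, RegSet.single_mul_single,
    Prod.mk_mul_mk, Prod.mk_mul_mk, one_mul, one_mul, mul_one, mul_one]

end RTensor

theorem Polycyclic.p_mul_q {m : ℕ} (i j : Fin m) :
    (p i * q j : Polycyclic m) = if i = j then 1 else 0 := by
  rw [p, q, ← qmk_mul]
  refine ((RingCon.eq _).2 (rCongGen_of (PolycyclicRel.matching i j))).trans ?_
  split_ifs <;> rfl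

/-! ### Bracket relations in the tensor product -/

section Brackets

variable {K : Type*} [IdemSemiring K] [IsRDioid K] {m : ℕ}

theorem tp_mul_tq (i j : Fin m) : tp K i * tq K j = if i = j then 1 else 0 := by
  rw [tp, tq, ← RTensor.inr_mul, Polycyclic.p_mul_q]
  split_ifs
  exacts [RTensor.inr_one, RTensor.inr_zero]

theorem tp_mul_tq_self (i : Fin m) : tp K i * tq K i = 1 := by
  rw [tp_mul_tq, if_pos rfl]

theorem tp_mul_tq_of_ne {i j : Fin m} (h : i ≠ j) : tp K i * tq K j = 0 := by
  rw [tp_mul_tq, if_neg h]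

theorem tp_mul_te (i : Fin m) : tp K i * te K m = tp K i := by
  rw [te, Finset.mul_sum, Finset.sum_eq_single i]
  · rw [← mul_assoc, tp_mul_tq_self, one_mul]
  · intro j _ hj
    rw [← mul_assoc, tp_mul_tq_of_ne hj.symm, zero_mul]
  · exact fun h => absurd (Finset.mem_univ i) h

theorem inl_mul_tp (k : K) (i : Fin m) : RTensor.inl k * tp K i = tp K i * RTensor.inl k :=
  RTensor.inl_mul_inr k _

/-! ### Stacks and the action of coefficients on them -/

variable [NeZero m]

/-- The stack contents `k p_0 p_{i_1} ⋯ p_{i_n}`, with `i_1, …, i_n` nonzero, together with the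
failure state `0`. -/
inductive IsStack : RTensor K (Polycyclic m) → Prop
  | zero : IsStack 0
  | base (k : K) : IsStack (RTensor.inl k * tp K 0)
  | push {s : RTensor K (Polycyclic m)} (i : Fin m) (hi : i ≠ 0) :
      IsStack s → IsStack (s * tp K i)

namespace IsStack

variable {s : RTensor K (Polycyclic m)}

theorem tp_zero : IsStack (tp K (0 : Fin m)) := by
  simpa [RTensor.inl_one] using IsStack.base (m := m) (1 : K)

/-- The new coefficient commutes past the brackets down to the bottom, where it merges with the old
one. -/
theorem mul_inl (hs : IsStack s) (k : K) : IsStack (s * RTensor.inl k) := by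
  induction hs with
  | zero => rw [zero_mul]; exact .zero
  | base k' =>
    rw [mul_assoc, ← inl_mul_tp, ← mul_assoc, ← RTensor.inl_mul]
    exact .base _
  | push i hi _ ih =>
    rw [mul_assoc, ← inl_mul_tp, ← mul_assoc]
    exact .push i hi ih

theorem mul_tq (hs : IsStack s) {j : Fin m} (hj : j ≠ 0) : IsStack (s * tq K j) := by
  cases hs with
  | zero => rw [zero_mul]; exact .zero
  | base k => rw [mul_assoc, tp_mul_tq_of_ne hj.symm, mul_zero]; exact .zero
  | push i hi hs =>
    rw [mul_assoc, tp_mul_tq]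
    split_ifs
    · rwa [mul_one]
    · rw [mul_zero]; exact .zero

/-- `π` tests for the bottom: it fixes `k p_0` and sends every higher stack to `0`. -/
theorem mul_pi (hs : IsStack s) : IsStack (s * (tq K 0 * tp K 0)) := by
  cases hs with
  | zero => rw [zero_mul]; exact .zero
  | base k =>
    rw [mul_assoc, ← mul_assoc (tp K 0), tp_mul_tq_self, one_mul]
    exact .base k
  | push i hi hs =>
    rw [mul_assoc, ← mul_assoc (tp K i), tp_mul_tq_of_ne hi, zero_mul, mul_zero]
    exact .zero

theorem mul_te (hs : IsStack s) : s * te K m = s := by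
  cases hs with
  | zero => rw [zero_mul]
  | base k => rw [mul_assoc, tp_mul_te]
  | push i hi hs => rw [mul_assoc, tp_mul_te]

/-- Popping `p_0` off a stack leaves an element that commutes with the image of `C_m'`. -/
theorem inr_mul_mul_tq_zero (hs : IsStack s) (c : Polycyclic m) :
    RTensor.inr c * (s * tq K 0) = s * tq K 0 * RTensor.inr c := by
  cases hs with
  | zero => rw [zero_mul, zero_mul, mul_zero]
  | base k => rw [mul_assoc, tp_mul_tq_self, mul_one, RTensor.inl_mul_inr]
  | push i hi hs => rw [mul_assoc, tp_mul_tq_of_ne hi, mul_zero, zero_mul, mul_zero]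

end IsStack

/-! ### Regular sets of pairs acting alike on stacks -/

variable (K m) in
/-- The pairs of elements that act in the same way on stacks. -/
def stackPairs : Submonoid (RTensor K (Polycyclic m) × RTensor K (Polycyclic m)) where
  -- Preservation of stacks is what lets the second factor of a product act after the first.
  carrier := {x | ∀ s, IsStack s → s * x.1 = s * x.2 ∧ IsStack (s * x.2)}
  one_mem' s hs := by
    rw [Prod.fst_one, Prod.snd_one, mul_one]
    exact ⟨rfl, hs⟩
  mul_mem' {x y} hx hy s hs := by
    obtain ⟨h₁, h₂⟩ := hx s hs
    obtain ⟨h₃, h₄⟩ := hy _ h₂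
    rw [Prod.fst_mul, Prod.snd_mul, ← mul_assoc, ← mul_assoc, h₁]
    exact ⟨h₃, h₄⟩

/-- `a` and `b` are the least upper bounds of the two projections of a regular set of pairs that
act in the same way on stacks. -/
def StackRelated (a b : RTensor K (Polycyclic m)) : Prop :=
  ∃ L : Set (RTensor K (Polycyclic m) × RTensor K (Polycyclic m)), IsRational L ∧
    L ⊆ stackPairs K m ∧ IsLUB (Prod.fst '' L) a ∧ IsLUB (Prod.snd '' L) b

namespace StackRelated

variable {a b a' b' : RTensor K (Polycyclic m)}

theorem of_mem (h : (a, b) ∈ stackPairs K m) : StackRelated a b :=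
  ⟨{(a, b)}, .singleton _, Set.singleton_subset_iff.2 h,
    by rw [Set.image_singleton]; exact isLUB_singleton,
    by rw [Set.image_singleton]; exact isLUB_singleton⟩

theorem refl_of (h : ∀ s, IsStack s → IsStack (s * a)) : StackRelated a a :=
  of_mem fun s hs => ⟨rfl, h s hs⟩

theorem zero : StackRelated (0 : RTensor K (Polycyclic m)) 0 :=
  refl_of fun s _ => by rw [mul_zero]; exact .zero

theorem one : StackRelated (1 : RTensor K (Polycyclic m)) 1 :=
  refl_of fun s hs => by rwa [mul_one]

theorem add (h : StackRelated a b) (h' : StackRelated a' b') :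
    StackRelated (a + a') (b + b') := by
  obtain ⟨L, hL, hs, h₁, h₂⟩ := h
  obtain ⟨L', hL', hs', h₁', h₂'⟩ := h'
  refine ⟨L ∪ L', hL.union hL', Set.union_subset hs hs', ?_, ?_⟩
  · rw [Set.image_union]; exact h₁.union_add h₁'
  · rw [Set.image_union]; exact h₂.union_add h₂'

theorem mul (h : StackRelated a b) (h' : StackRelated a' b') :
    StackRelated (a * a') (b * b') := by
  obtain ⟨L, hL, hs, h₁, h₂⟩ := h
  obtain ⟨L', hL', hs', h₁', h₂'⟩ := h'
  refine ⟨L * L', hL.mul hL', ?_, .image_mul (MonoidHom.fst _ _) hL hL' h₁ h₁',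
    .image_mul (MonoidHom.snd _ _) hL hL' h₂ h₂'⟩
  rintro _ ⟨x, hx, y, hy, rfl⟩
  exact mul_mem (hs hx) (hs' hy)

/-- Pairs acting alike form a submonoid, so it contains the one generated by `L`; the projections
are homomorphisms and carry it to the generated submonoids of the projections. -/
theorem star (h : StackRelated a b) : StackRelated (rstar a) (rstar b) := by
  obtain ⟨L, hL, hs, h₁, h₂⟩ := h
  exact ⟨_, hL.star, Submonoid.closure_le.2 hs, .image_closure (MonoidHom.fst _ _) hL h₁,
    .image_closure (MonoidHom.snd _ _) hL h₂⟩

/-- Here `e` stays one element and is not split into its summands `q_i p_i`, which do not fix all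
stacks individually. -/
theorem te_one : StackRelated (te K m) 1 :=
  of_mem fun s hs => by
    rw [mul_one]
    exact ⟨hs.mul_te, hs⟩

theorem _root_.IsPiDenoted.stackRelated (h : IsPiDenoted K a) : StackRelated a a := by
  induction h with
  | coeff k => exact refl_of fun s hs => hs.mul_inl k
  | pi => exact refl_of fun s hs => hs.mul_pi
  | opening i hi => exact refl_of fun s hs => .push i hi hs
  | closing i hi => exact refl_of fun s hs => hs.mul_tq hi
  | zero => exact zero
  | one => exact one
  | add _ _ h₁ h₂ => exact h₁.add h₂
  | mul _ _ h₁ h₂ => exact h₁.mul h₂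
  | star _ h => exact h.star

theorem eval (φ : RPolynomial (RTensor K (Polycyclic m)))
    (hφ : φ.CoeffsIn {c | IsPiDenoted K c}) (h : StackRelated a b) :
    StackRelated (φ.eval a) (φ.eval b) := by
  induction φ with
  | zero => exact zero
  | epsilon => exact one
  | char c =>
    cases c with
    | none => exact h
    | some c => exact IsPiDenoted.stackRelated hφ
  | plus φ ψ h₁ h₂ => exact (h₁ hφ.1).add (h₂ hφ.2)
  | comp φ ψ h₁ h₂ => exact (h₁ hφ.1).mul (h₂ hφ.2)
  | star φ h => exact (h hφ).star

theorem tp_mul_mul_tq (h : StackRelated a b) :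
    tp K 0 * a * tq K 0 = tp K 0 * b * tq K 0 := by
  obtain ⟨L, hL, hs, h₁, h₂⟩ := h
  have h₁' := h₁.mul_mul (hL.image (MonoidHom.fst _ _)) (tp K 0) (tq K 0)
  have h₂' := h₂.mul_mul (hL.image (MonoidHom.snd _ _)) (tp K 0) (tq K 0)
  rw [Set.image_image] at h₁' h₂'
  refine h₁'.unique ?_
  convert h₂' using 1
  -- The outer factor `p_0` is itself the initial stack, so both components of a pair give the same
  -- element.
  exact Set.image_congr fun x hx => congrArg (· * tq K 0) (hs hx _ .tp_zero).1

theorem tp_mul_mul_tq_mem (h : StackRelated a b) :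
    tp K 0 * b * tq K 0 ∈ polycyclicCentralizer K m := by
  obtain ⟨L, hL, hs, -, h₂⟩ := h
  have hR := hL.image (MonoidHom.snd _ _)
  have h₂' := h₂.mul_mul hR (tp K 0) (tq K 0)
  -- `IsLUB.commute` needs the set of all `p_0 x q_0` to be regular; it is a product with two
  -- singletons.
  have hR' := ((IsRational.singleton (tp K 0)).mul hR).mul (.singleton (tq K 0))
  rw [Set.singleton_mul, Set.mul_singleton, Set.image_image] at hR'
  rintro _ ⟨c, rfl⟩
  refine h₂'.commute hR' ?_
  rintro _ ⟨_, ⟨x, hx, rfl⟩, rfl⟩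
  exact (hs hx _ .tp_zero).2.inr_mul_mul_tq_zero c

end StackRelated

end Brackets

theorem mainTheorem8 {K : Type*} [IdemSemiring K] [IsRDioid K] {m : ℕ} [NeZero m] (hm : 2 ≤ m)
    (φ : RPolynomial (RTensor K (Polycyclic m)))
    (hφ : φ.CoeffsIn {c | IsPiDenoted K c}) :
    tp K 0 * φ.eval (te K m) * tq K 0 = tp K 0 * φ.eval 1 * tq K 0 ∧
      tp K 0 * φ.eval 1 * tq K 0 ∈ polycyclicCentralizer K m := by
  have h := StackRelated.eval φ hφ StackRelated.te_one
  exact ⟨h.tp_mul_mul_tq, h.tp_mul_mul_tq_mem⟩
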